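/- Let $T$ be a finite rooted tree with root $r$, at least two vertices, and optionally labels on its vertices; let $n$ be the number of vertices of $T$. An automorphism of $T$ is a bijection of the vertices that preserves the root, the parent–child relation and the labels (if any). A leaf is a vertex without children. A $j$-numbering of $T$ assigns to each vertex a natural number such that two vertices lie in the same orbit of the automorphism group of $T$ if and only if they have the same depth and the same number. Suppose that $T$ is given by lists of the children of each vertex, in any order, together with a $j$-numbering. Consider the following recursive algorithm, called on the root. hasNiceAutomorphism($r$): for each $j$-number that occurs among the children of $r$, take one child $v$ of $r$ with that number and let $k_v$ be the number of children of $r$ with the same number as $v$. If $k_v$ is odd and $v$ is a leaf, return "false". If $k_v$ is odd, $v$ is not a leaf and hasNiceAutomorphism($v$), called on the subtree $T_v$ rooted at $v$, returns "false", return "false". After all $j$-numbers have been treated, return "true". Then the algorithm returns "true" if and only if $T$ has an automorphism $\psi$ which is a fixed-point-free involution on the leaves, that is, $\psi(x)\neq x$ and $\psi(\psi(x))=x$ for every leaf $x$. Moreover, the algorithm always halts, and its running time is $O(n^2)$: there is an absolute constant $C$ such that it performs at most $C n^2$ elementary operations on every such input, where looking up and comparing two $j$-numbers counts as one operation. -/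

import Mathlib

/-! Rooted trees are Mathlib's `RootedTree`: the order is "is an ancestor of or equal to", `⊥` is the
root, `w` is a child of `v` when `v ⋖ w`, and the subtree rooted at `v` is `Set.Ici v`. -/

universe u v

namespace TreeInvolution

/-- A leaf is a vertex without descendants other than itself. -/
def IsLeaf {T : RootedTree.{u}} (x : T) : Prop := IsMax x

/-- The depth of a vertex: the number of its proper ancestors. -/
noncomputable def depth {T : RootedTree.{u}} (x : T) : ℕ := (Set.Iio x).ncard

/-- An automorphism of a labeled rooted tree: a bijection of the vertices that preserves (in both
directions) the ancestor relation, and preserves the labels.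
For an unlabeled tree take a constant `label`. -/
structure LabeledAut {T : RootedTree.{u}} {L : Type v} (label : T → L) where
  toOrderIso : T ≃o T
  label_map : ∀ x, label (toOrderIso x) = label x

/-- The automorphism acts on the leaves as an involution without fixed points. -/
def LabeledAut.IsFixedPointFreeInvolutionOnLeaves {T : RootedTree.{u}} {L : Type v} {label : T → L}
    (σ : LabeledAut label) : Prop :=
  ∀ x : T, IsLeaf x → σ.toOrderIso x ≠ x ∧ σ.toOrderIso (σ.toOrderIso x) = x

/-- `j` is a `j`-numbering: the `j`-number together with the depth partitions the vertices into the
orbits of the automorphism group. -/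
def IsJNumbering {T : RootedTree.{u}} {L : Type v} (label : T → L) (j : T → ℕ) : Prop :=
  ∀ x y : T, (depth x = depth y ∧ j x = j y) ↔ ∃ σ : LabeledAut label, σ.toOrderIso x = y

/-- `children` stores, for each vertex, the list of its children, in an arbitrary order and without
repetitions. -/
def IsChildLists {T : RootedTree.{u}} (children : T → List T) : Prop :=
  ∀ x : T, (children x).Nodup ∧ ∀ y : T, y ∈ children x ↔ x ⋖ y

/-! ### The algorithm, as a small-step machine

The machine executes the recursive procedure
```
hasNiceAutomorphism(r):
  for each child x of r with distinct j-number: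
    let k be the number of children of r with the same j-number as x
    if k is odd:
      if x is a leaf: return false
      else if hasNiceAutomorphism(x) = false: return false
  return true
```
with an explicit call stack. One step consists of a bounded number of elementary operations: it
inspects or moves the first cell of a linked list, looks up and compares two `j`-numbers,
increments a counter or tests its parity, pushes or pops one stack entry. -/

/-- Machine states over a vertex type `V`. A suspended call is represented by the list of those
children of its vertex that its loop still has to treat; `stack` lists the suspended calls,
innermost first. -/
inductive State (V : Type u) : Type u
  /-- At the head of the loop of the current call; `todo` holds the children of the current vertex
  whose `j`-number has not been treated yet. -/
  | loop (todo : List V) (stack : List (List V))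
  /-- Treating the child `x`: `k` children with the `j`-number of `x` have been found so far
  (including `x`), those in `unread` have not been looked at, and those in `other` have a different
  `j`-number. -/
  | count (x : V) (k : ℕ) (unread other : List V) (stack : List (List V))
  /-- The current call returns `b` to its caller; with an empty stack the machine has halted with
  output `b`. -/
  | ret (b : Bool) (stack : List (List V))

/-- One step of the machine. -/
def step {V : Type u} (children : V → List V) (j : V → ℕ) : State V → State V
  | .loop [] s => .ret true s
  | .loop (x :: xs) s => .count x 1 xs [] s
  | .count x k (y :: ys) other s =>
      if j y = j x then .count x (k + 1) ys other s else .count x k ys (y :: other) s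
  | .count x k [] other s =>
      if k % 2 = 1 then
        match children x with
        | [] => .ret false s
        | c :: cs => .loop (c :: cs) (other :: s)
      else .loop other s
  | .ret true (todo :: s) => .loop todo s
  | .ret false (_ :: s) => .ret false s
  | .ret b [] => .ret b []

/-- The state after `t` steps of the run started on the vertex `r`. -/
def run {V : Type u} (children : V → List V) (j : V → ℕ) (r : V) (t : ℕ) : State V :=
  (step children j)^[t] (.loop (children r) [])

/-- Started on `r`, the algorithm has halted with output `b` after at most `t` steps. (A halted
machine does not change its state any more, so the output is unique.) -/
def ReturnsWithin {V : Type u} (children : V → List V) (j : V → ℕ) (r : V) (b : Bool) (t : ℕ) :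
    Prop :=
  run children j r t = .ret b []

/-- Started on `r`, the algorithm halts with output `b`. -/
def Returns {V : Type u} (children : V → List V) (j : V → ℕ) (r : V) (b : Bool) : Prop :=
  ∃ t, ReturnsWithin children j r b t

/-- Every finite labeled rooted tree has a `j`-numbering, with numbers between `1` and `n`. -/
theorem exists_isJNumbering {T : RootedTree.{u}} [Finite T] {L : Type v} (label : T → L) :
    ∃ j : T → ℕ, IsJNumbering label j ∧ ∀ x, 1 ≤ j x ∧ j x ≤ Nat.card T := by
  classical
  let S : Setoid T :=
    { r := fun x y => ∃ σ : LabeledAut label, σ.toOrderIso x = y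
      iseqv :=
        { refl := fun x => ⟨⟨OrderIso.refl _, fun _ => rfl⟩, rfl⟩
          symm := by
            rintro x y ⟨σ, rfl⟩
            exact ⟨⟨σ.toOrderIso.symm, fun z => by
              simpa using (σ.label_map (σ.toOrderIso.symm z)).symm⟩, by simp⟩
          trans := by
            rintro x y z ⟨σ, rfl⟩ ⟨τ, rfl⟩
            exact ⟨⟨σ.toOrderIso.trans τ.toOrderIso, fun z => by
              simp [τ.label_map, σ.label_map]⟩, by simp⟩ } }
  let e : T → Fin (Nat.card T) := fun x => Finite.equivFin T (Quotient.out (Quotient.mk S x))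
  refine ⟨fun x => e x + 1, fun x y => ?_, fun x => ⟨by simp, (e x).2⟩⟩
  constructor
  · rintro ⟨-, h⟩
    have h1 : e x = e y := Fin.ext (by simpa using h)
    have h2 := (Finite.equivFin T).injective h1
    exact Quotient.exact (Quotient.out_injective h2)
  · rintro ⟨σ, h⟩
    refine ⟨?_, ?_⟩
    · have : Set.Iio y = σ.toOrderIso '' Set.Iio x := by rw [← h]; simp
      rw [depth, depth, this, Set.ncard_image_of_injective _ σ.toOrderIso.injective]
    · have : (Quotient.mk S x) = Quotient.mk S y := Quotient.sound ⟨σ, h⟩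
      simp only [e, this]

end TreeInvolution

namespace TreeInvolution

open Finset

/-! ### Children in a rooted tree -/

section Tree

variable {T : RootedTree.{u}}

/-! Call `v` nice if `NiceAt` holds there. The automorphism in it acts on the whole tree, so orbits,
and with them the given numbering, need not be recomputed in subtrees. A leaf is never nice. A
non-leaf is nice iff every child whose class among its siblings is odd is nice
(`IsJNumbering.niceAt_iff_forall`): an involution must fix a member of an odd class, and conversely
classes can be paired off up to one fixed child, with the pieces glued together.

The machine evaluates this criterion. All members of a class are equally nice, so one representative
suffices. The time bound is 2·(subtree size)², by induction over subtrees: the overhead of scanning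
siblings is absorbed by the cross terms of the square (`reachesIn_loop`). -/

theorem eq_of_covBy_of_le {v x y z : T} (hx : v ⋖ x) (hy : v ⋖ y) (hxz : x ≤ z) (hyz : y ≤ z) :
    x = y := by
  rcases le_total_of_directed hyz hxz with h | h
  · exact h.eq_or_lt.resolve_right fun h' => hy.2 hx.1 h'
  · exact (h.eq_or_lt.resolve_right fun h' => hx.2 hy.1 h').symm

theorem le_of_lt_of_covBy {v x z : T} (hx : v ⋖ x) (hz : z < x) : z ≤ v := by
  rcases le_total_of_directed hx.1.le hz.le with h | h
  · exact h
  · exact (h.eq_or_lt.resolve_right fun h' => hx.2 h' hz).ge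

theorem depth_eq_of_covBy {v x y : T} (hx : v ⋖ x) (hy : v ⋖ y) : depth x = depth y := by
  have key : ∀ {w : T}, v ⋖ w → Set.Iio w = Set.Iic v := fun hw =>
    Set.ext fun z => ⟨le_of_lt_of_covBy hw, fun h => lt_of_le_of_lt h hw.1⟩
  rw [depth, depth, key hx, key hy]

theorem exists_isLeaf_ge [Finite T] (x : T) : ∃ l, x ≤ l ∧ IsLeaf l := by
  obtain ⟨l, hl, hm⟩ := (Set.toFinite (Set.Ici x)).exists_le_maximal (a := x) le_rfl
  exact ⟨l, hl, fun y hy => hm.2 (hm.1.trans hy) hy⟩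

theorem one_add_sum_ncard_Ici_le [Finite T] {v : T} {s : Finset T} (hs : ∀ x ∈ s, v ⋖ x) :
    1 + ∑ x ∈ s, (Set.Ici x).ncard ≤ (Set.Ici v).ncard := by
  classical
  have := Fintype.ofFinite T
  have hc : ∀ x : T, (Set.Ici x).ncard = #{y | x ≤ y} := fun x => by
    rw [← Set.ncard_coe_finset]; congr 1; ext; simp
  simp only [hc]
  rw [← card_biUnion, add_comm, ← card_insert_of_notMem (a := v)]
  · refine card_le_card fun z hz => ?_
    simp only [mem_insert, mem_biUnion, mem_filter, mem_univ, true_and] at hz ⊢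
    rcases hz with rfl | ⟨x, hx, hxz⟩
    · exact le_rfl
    · exact (hs x hx).1.le.trans hxz
  · simp only [mem_biUnion, mem_filter, mem_univ, true_and, not_exists, not_and]
    exact fun x hx h => (hs x hx).1.not_ge h
  · intro x hx y hy hxy
    refine disjoint_left.2 fun z hz hz' => hxy ?_
    simp only [mem_filter, mem_univ, true_and] at hz hz'
    exact eq_of_covBy_of_le (hs x hx) (hs y hy) hz hz'

end Tree

/-! ### Gluing automorphisms along the children of a vertex -/

section Glue

variable {T : RootedTree.{u}} {L : Type v} {label : T → L}

/-- The inverse automorphism. -/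
def LabeledAut.symm (σ : LabeledAut label) : LabeledAut label :=
  ⟨σ.toOrderIso.symm, fun z => by simpa using (σ.label_map (σ.toOrderIso.symm z)).symm⟩

/-- The composition of two automorphisms. -/
def LabeledAut.trans (σ τ : LabeledAut label) : LabeledAut label :=
  ⟨σ.toOrderIso.trans τ.toOrderIso, fun z => by simp [τ.label_map, σ.label_map]⟩

open Classical in
/-- The map that acts as `τ x` on the subtree of each child `x` of `v`, and as the identity outside
these subtrees. -/
noncomputable def glue (v : T) (τ : T → LabeledAut label) (z : T) : T :=
  if h : ∃ x, v ⋖ x ∧ x ≤ z then (τ h.choose).toOrderIso z else z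

theorem glue_of_le {v x z : T} (τ : T → LabeledAut label) (hx : v ⋖ x) (hxz : x ≤ z) :
    glue v τ z = (τ x).toOrderIso z := by
  have h : ∃ x, v ⋖ x ∧ x ≤ z := ⟨x, hx, hxz⟩
  rw [glue, dif_pos h, eq_of_covBy_of_le h.choose_spec.1 hx h.choose_spec.2 hxz]

theorem glue_of_not {v z : T} (τ : T → LabeledAut label) (h : ¬ ∃ x, v ⋖ x ∧ x ≤ z) :
    glue v τ z = z := dif_neg h

theorem label_glue (v : T) (τ : T → LabeledAut label) (z : T) : label (glue v τ z) = label z := by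
  unfold glue
  split_ifs
  · exact (τ _).label_map z
  · rfl

theorem monotone_glue {v : T} {p : T → T} {τ : T → LabeledAut label} (hp : ∀ x, v ⋖ x → v ⋖ p x)
    (hτ : ∀ x, v ⋖ x → (τ x).toOrderIso x = p x) : Monotone (glue v τ) := by
  intro z w hzw
  by_cases hz : ∃ x, v ⋖ x ∧ x ≤ z
  · obtain ⟨x, hx, hxz⟩ := hz
    rw [glue_of_le τ hx hxz, glue_of_le τ hx (hxz.trans hzw)]
    exact (τ x).toOrderIso.monotone hzw
  · rw [glue_of_not τ hz]
    by_cases hw : ∃ x, v ⋖ x ∧ x ≤ w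
    · obtain ⟨x, hx, hxw⟩ := hw
      rw [glue_of_le τ hx hxw]
      -- A vertex outside all child subtrees but below `w` is an ancestor of `v` or `v` itself, so
      -- it stays below every `p x`.
      have hzx : z < x := by
        rcases le_total_of_directed hxw hzw with h | h
        · exact h.lt_of_ne fun e => hz ⟨x, hx, e.ge⟩
        · exact absurd ⟨x, hx, h⟩ hz
      calc z ≤ v := le_of_lt_of_covBy hx hzx
        _ ≤ p x := (hp x hx).1.le
        _ = (τ x).toOrderIso x := (hτ x hx).symm
        _ ≤ _ := (τ x).toOrderIso.monotone hxw
    · rwa [glue_of_not τ hw]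

/-- The hypothesis is pointwise in `z`, so this serves both for two-sided inverses and for
involutivity at a single leaf. -/
theorem glue_glue {v : T} {p : T → T} {τ τ' : T → LabeledAut label} (hp : ∀ x, v ⋖ x → v ⋖ p x)
    (hτ : ∀ x, v ⋖ x → (τ x).toOrderIso x = p x) (z : T)
    (h : ∀ x, v ⋖ x → x ≤ z → (τ' (p x)).toOrderIso ((τ x).toOrderIso z) = z) :
    glue v τ' (glue v τ z) = z := by
  by_cases hz : ∃ x, v ⋖ x ∧ x ≤ z
  · obtain ⟨x, hx, hxz⟩ := hz
    rw [glue_of_le τ hx hxz, glue_of_le τ' (hp x hx), h x hx hxz]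
    rw [← hτ x hx]
    exact (τ x).toOrderIso.monotone hxz
  · rw [glue_of_not τ hz, glue_of_not τ' hz]

theorem exists_labeledAut_eq_glue {v : T} {p : T → T} {τ : T → LabeledAut label}
    (hp : ∀ x, v ⋖ x → v ⋖ p x) (hpp : ∀ x, v ⋖ x → p (p x) = x)
    (hτ : ∀ x, v ⋖ x → (τ x).toOrderIso x = p x) :
    ∃ σ : LabeledAut label, ∀ z, σ.toOrderIso z = glue v τ z := by
  let τ' : T → LabeledAut label := fun x => (τ (p x)).symm
  have hτ' : ∀ x, v ⋖ x → (τ' x).toOrderIso x = p x := fun x hx => by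
    change (τ (p x)).toOrderIso.symm x = p x
    rw [OrderIso.symm_apply_eq, hτ _ (hp x hx), hpp x hx]
  have h1 : Function.LeftInverse (glue v τ') (glue v τ) := fun z =>
    glue_glue hp hτ z fun x hx _ => by
      change (τ (p (p x))).toOrderIso.symm _ = z
      rw [hpp x hx, OrderIso.symm_apply_apply]
  have h2 : Function.LeftInverse (glue v τ) (glue v τ') := fun z =>
    glue_glue hp hτ' z fun x _ _ => by
      change (τ (p x)).toOrderIso ((τ (p x)).toOrderIso.symm z) = z
      rw [OrderIso.apply_symm_apply]
  refine ⟨⟨Equiv.toOrderIso ⟨glue v τ, glue v τ', h1, h2⟩ (monotone_glue hp hτ)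
    (monotone_glue hp hτ'), label_glue v τ⟩, fun z => rfl⟩

end Glue

/-! ### Vertices whose subtree has a good automorphism -/

section Nice

variable {T : RootedTree.{u}} {L : Type v} {label : T → L} {j : T → ℕ}

variable (label) in
/-- Some automorphism fixes `v` and is a fixed-point-free involution on the leaves below `v`. -/
def NiceAt (v : T) : Prop :=
  ∃ σ : LabeledAut label, σ.toOrderIso v = v ∧
    ∀ x, v ≤ x → IsLeaf x → σ.toOrderIso x ≠ x ∧ σ.toOrderIso (σ.toOrderIso x) = x

theorem niceAt_bot :
    NiceAt label (⊥ : T) ↔ ∃ σ : LabeledAut label, σ.IsFixedPointFreeInvolutionOnLeaves :=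
  ⟨fun ⟨σ, _, h⟩ => ⟨σ, fun x => h x bot_le⟩,
    fun ⟨σ, h⟩ => ⟨σ, map_bot σ.toOrderIso, fun x _ => h x⟩⟩

theorem IsLeaf.not_niceAt {v : T} (hv : IsLeaf v) : ¬ NiceAt label v :=
  fun ⟨_, h, h'⟩ => (h' v le_rfl hv).1 h

theorem NiceAt.map {v : T} (h : NiceAt label v) (τ : LabeledAut label) :
    NiceAt label (τ.toOrderIso v) := by
  obtain ⟨σ, hv, hσ⟩ := h
  have key : ∀ z, ((τ.symm.trans σ).trans τ).toOrderIso z =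
    τ.toOrderIso (σ.toOrderIso (τ.toOrderIso.symm z)) := fun z => rfl
  refine ⟨(τ.symm.trans σ).trans τ, by simp [key, hv], fun x hx hl => ?_⟩
  obtain ⟨h1, h2⟩ := hσ (τ.toOrderIso.symm x) ((OrderIso.le_symm_apply _).2 hx)
    ((OrderIso.isMax_apply _).2 hl)
  refine ⟨fun e => h1 ?_, by simp [key, h2]⟩
  rw [OrderIso.eq_symm_apply]
  exact e

theorem IsJNumbering.exists_labeledAut (hj : IsJNumbering label j) {v x y : T} (hx : v ⋖ x)
    (hy : v ⋖ y) (h : j x = j y) : ∃ τ : LabeledAut label, τ.toOrderIso x = y :=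
  (hj x y).1 ⟨depth_eq_of_covBy hx hy, h⟩

theorem IsJNumbering.niceAt_iff (hj : IsJNumbering label j) {v x y : T} (hx : v ⋖ x)
    (hy : v ⋖ y) (h : j x = j y) : NiceAt label x ↔ NiceAt label y := by
  obtain ⟨τ, rfl⟩ := hj.exists_labeledAut hx hy h
  refine ⟨fun h => h.map τ, fun h => ?_⟩
  have := h.map τ.symm
  rwa [show τ.symm.toOrderIso (τ.toOrderIso x) = x from τ.toOrderIso.symm_apply_apply x] at this

theorem NiceAt.of_covBy [Finite T] (hj : IsJNumbering label j) {v x : T} (h : NiceAt label v)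
    {s : Finset T} (hs : ∀ y, y ∈ s ↔ v ⋖ y) (hx : v ⋖ x) (hodd : Odd #{y ∈ s | j y = j x}) :
    NiceAt label x := by
  obtain ⟨σ, hv, hσ⟩ := h
  have hcov : ∀ y, v ⋖ y → v ⋖ σ.toOrderIso y := fun y hy => by
    have := (apply_covBy_apply_iff σ.toOrderIso).2 hy
    rwa [hv] at this
  -- `σ` squared fixes a leaf above `y` in the order, and that leaf lies over only one child of `v`.
  have hinv : ∀ y, v ⋖ y → σ.toOrderIso (σ.toOrderIso y) = y := fun y hy => by
    obtain ⟨l, hyl, hl⟩ := exists_isLeaf_ge y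
    refine eq_of_covBy_of_le (hcov _ (hcov _ hy)) hy ?_ hyl
    conv_rhs => rw [← (hσ l (hy.1.le.trans hyl) hl).2]
    exact σ.toOrderIso.monotone (σ.toOrderIso.monotone hyl)
  obtain ⟨y, hy, hyx, hfix⟩ : ∃ y, v ⋖ y ∧ j y = j x ∧ σ.toOrderIso y = y := by
    by_contra! hne
    -- Without a fixed child the class splits into 2-cycles, so its size vanishes mod 2.
    have h0 : ∑ y ∈ s with j y = j x, (1 : ZMod 2) = 0 := by
      refine sum_involution (fun y _ => σ.toOrderIso y) (fun _ _ => by decide) ?_ ?_ ?_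
      · intro y hy _
        rw [mem_filter, hs] at hy
        exact hne y hy.1 hy.2
      · intro y hy
        rw [mem_filter, hs] at hy ⊢
        exact ⟨hcov y hy.1, (((hj y _).2 ⟨σ, rfl⟩).2.symm).trans hy.2⟩
      · intro y hy
        rw [mem_filter, hs] at hy
        exact hinv y hy.1
    rw [sum_const, nsmul_one, ZMod.natCast_eq_zero_iff_even] at h0
    exact (Nat.not_even_iff_odd.2 hodd) h0
  exact (hj.niceAt_iff hy hx hyx).1 ⟨σ, hfix, fun z hz => hσ z (hy.1.le.trans hz)⟩

/-- A finite set in which the elements of the odd classes of `j` satisfy `P` has a class-preserving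
involution all of whose fixed points satisfy `P`. -/
theorem exists_involution {V : Type*} (j : V → ℕ) (P : V → Prop) (s : Finset V)
    (h : ∀ x ∈ s, Odd #{y ∈ s | j y = j x} → P x) :
    ∃ p : V → V, ∀ x ∈ s, p x ∈ s ∧ p (p x) = x ∧ j (p x) = j x ∧ (p x = x → P x) := by
  classical
  induction s using Finset.strongInduction with
  | H s ih =>
    obtain rfl | ⟨a, ha⟩ := s.eq_empty_or_nonempty
    · exact ⟨id, by simp⟩
    -- Removing a pair from one class preserves all parities; if `a` has no partner, its class is a
    -- singleton, hence odd.
    by_cases hb : ∃ b ∈ s, b ≠ a ∧ j b = j a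
    · obtain ⟨b, hbs, hba, hjb⟩ := hb
      have hbe : b ∈ s.erase a := mem_erase.2 ⟨hba, hbs⟩
      obtain ⟨p, hp⟩ := ih ((s.erase a).erase b)
        ((erase_ssubset hbe).trans (erase_ssubset ha)) fun x hx hodd => by
          refine h x (mem_of_mem_erase (mem_of_mem_erase hx)) ?_
          rw [filter_erase, filter_erase] at hodd
          by_cases hjx : j a = j x
          · rw [card_erase_of_mem, card_erase_of_mem] at hodd
            · have h2 : 1 < #{y ∈ s | j y = j x} := one_lt_card.2
                ⟨a, by simp [ha, hjx], b, by simp [hbs, hjb, hjx], hba.symm⟩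
              rw [Nat.odd_iff] at hodd ⊢
              lia
            · simp [ha, hjx]
            · simp [hbs, hba, hjb, hjx]
          · rwa [erase_eq_of_notMem, erase_eq_of_notMem] at hodd
            · simp [hjx]
            · simp [hjb, hjx]
      refine ⟨fun x => if x = a then b else if x = b then a else p x, fun x hx => ?_⟩
      by_cases hxa : x = a
      · subst hxa
        simp [hbs, hba, hjb]
      by_cases hxb : x = b
      · subst hxb
        simp [ha, hba, hjb, hba.symm]
      obtain ⟨h1, h2, h3, h4⟩ := hp x (by simp [hx, hxa, hxb])
      simp only [mem_erase] at h1
      simp [hxa, hxb, h1, h2, h3]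
      exact h4
    · push Not at hb
      obtain ⟨p, hp⟩ := ih (s.erase a) (erase_ssubset ha) fun x hx hodd => by
          refine h x (mem_of_mem_erase hx) ?_
          rw [mem_erase] at hx
          rwa [filter_erase, erase_eq_of_notMem] at hodd
          simpa [ha] using (hb x hx.2 hx.1).symm
      refine ⟨fun x => if x = a then a else p x, fun x hx => ?_⟩
      by_cases hxa : x = a
      · subst hxa
        simp only [hx, if_true, true_and, forall_const]
        refine h x hx ?_
        have : ({y ∈ s | j y = j x} : Finset V) = {x} := by
          ext y
          simp only [mem_filter, mem_singleton]
          exact ⟨fun hy => by_contra fun e => hb y hy.1 e hy.2, fun e => by simp [e, hx]⟩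
        simp [this]
      obtain ⟨h1, h2, h3, h4⟩ := hp x (by simp [hx, hxa])
      simp only [mem_erase] at h1
      simp [hxa, h1, h2, h3]
      exact h4

theorem IsJNumbering.niceAt_of_forall [Finite T] (hj : IsJNumbering label j) {v : T}
    (hv : ¬ IsLeaf v) {s : Finset T} (hs : ∀ y, y ∈ s ↔ v ⋖ y)
    (h : ∀ x ∈ s, Odd #{y ∈ s | j y = j x} → NiceAt label x) : NiceAt label v := by
  classical
  obtain ⟨p, hp⟩ := exists_involution j (NiceAt label) s h
  simp only [hs] at hp
  obtain ⟨n, ⟨e⟩⟩ := Finite.exists_equiv_fin T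
  have key : ∀ x, ∃ τ : LabeledAut label, v ⋖ x → τ.toOrderIso x = p x ∧ (p x = x →
      ∀ z, x ≤ z → IsLeaf z → τ.toOrderIso z ≠ z ∧ τ.toOrderIso (τ.toOrderIso z) = z) := by
    intro x
    by_cases hx : v ⋖ x
    · obtain ⟨h1, h2, h3, h4⟩ := hp x hx
      by_cases hpx : p x = x
      · obtain ⟨τ, h5, h6⟩ := h4 hpx
        exact ⟨τ, fun _ => ⟨h5.trans hpx.symm, fun _ => h6⟩⟩
      · obtain ⟨τ, h5⟩ := hj.exists_labeledAut hx h1 h3.symm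
        exact ⟨τ, fun _ => ⟨h5, fun h => absurd h hpx⟩⟩
    · exact ⟨⟨OrderIso.refl T, fun _ => rfl⟩, fun h => absurd h hx⟩
  choose τ₀ hτ₀ using key
  -- The enumeration `e` orients each swapped pair, so that the two automorphisms used on it are
  -- mutually inverse.
  let τ : T → LabeledAut label := fun x => if e (p x) < e x then (τ₀ (p x)).symm else τ₀ x
  have hτ : ∀ x, v ⋖ x → (τ x).toOrderIso x = p x := fun x hx => by
    by_cases hlt : e (p x) < e x
    · simp only [τ, if_pos hlt]
      change (τ₀ (p x)).toOrderIso.symm x = p x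
      rw [OrderIso.symm_apply_eq, (hτ₀ _ (hp x hx).1).1, (hp x hx).2.1]
    · simp only [τ, if_neg hlt]
      exact (hτ₀ x hx).1
  obtain ⟨σ, hσ⟩ := exists_labeledAut_eq_glue (fun x hx => (hp x hx).1)
    (fun x hx => (hp x hx).2.1) hτ
  refine ⟨σ, ?_, fun z hvz hz => ?_⟩
  · rw [hσ, glue_of_not]
    rintro ⟨x, hx, hxv⟩
    exact hx.1.not_ge hxv
  have hlt : v < z := hvz.lt_of_ne fun e => hv (e ▸ hz)
  obtain ⟨x, hx, hxz⟩ := exists_covBy_le_of_lt hlt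
  obtain ⟨h1, h2, -, -⟩ := hp x hx
  simp only [hσ]
  by_cases hpx : p x = x
  · have hx0 : τ x = τ₀ x := if_neg (by simp [hpx])
    have := (hτ₀ x hx).2 hpx z hxz hz
    refine ⟨by rw [glue_of_le τ hx hxz, hx0]; exact this.1, glue_glue (p := p)
      (fun x hx => (hp x hx).1) hτ z fun y hy hyz => ?_⟩
    obtain rfl := eq_of_covBy_of_le hx hy hxz hyz
    rw [hpx, hx0]
    exact this.2
  · refine ⟨fun h => hpx ?_, glue_glue (p := p) (fun x hx => (hp x hx).1) hτ z fun y hy hyz => ?_⟩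
    · refine eq_of_covBy_of_le h1 hx ?_ hxz
      rw [← h, glue_of_le τ hx hxz, ← hτ x hx]
      exact (τ x).toOrderIso.monotone hxz
    · obtain rfl := eq_of_covBy_of_le hx hy hxz hyz
      have hne : e (p x) ≠ e x := fun h => hpx (e.injective h)
      rcases hne.lt_or_gt with hlt | hlt
      · simp only [τ, h2, if_pos hlt, if_neg hlt.not_gt]
        exact (τ₀ (p x)).toOrderIso.apply_symm_apply z
      · simp only [τ, h2, if_pos hlt, if_neg hlt.not_gt]
        exact (τ₀ x).toOrderIso.symm_apply_apply z

theorem IsJNumbering.niceAt_iff_forall [Finite T] (hj : IsJNumbering label j) {v : T}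
    (hv : ¬ IsLeaf v) {s : Finset T} (hs : ∀ y, y ∈ s ↔ v ⋖ y) :
    NiceAt label v ↔ ∀ x ∈ s, Odd #{y ∈ s | j y = j x} → NiceAt label x :=
  ⟨fun h x hx => h.of_covBy hj hs ((hs x).1 hx), hj.niceAt_of_forall hv hs⟩

end Nice

/-! ### The machine -/

section Machine

/-- `f` leads from `a` to `b` in at most `n` steps. -/
def ReachesIn {S : Type*} (f : S → S) (n : ℕ) (a b : S) : Prop :=
  ∃ t ≤ n, f^[t] a = b

theorem ReachesIn.trans {S : Type*} {f : S → S} {m n : ℕ} {a b c : S} (h₁ : ReachesIn f m a b)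
    (h₂ : ReachesIn f n b c) : ReachesIn f (m + n) a c := by
  obtain ⟨t, ht, rfl⟩ := h₁
  obtain ⟨t', ht', rfl⟩ := h₂
  exact ⟨t' + t, by lia, Function.iterate_add_apply f t' t a⟩

theorem ReachesIn.mono {S : Type*} {f : S → S} {m n : ℕ} {a b : S} (h : ReachesIn f m a b)
    (hmn : m ≤ n) : ReachesIn f n a b := by
  obtain ⟨t, ht, h⟩ := h
  exact ⟨t, ht.trans hmn, h⟩

theorem ReachesIn.single {S : Type*} {f : S → S} {a b : S} (h : f a = b) : ReachesIn f 1 a b :=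
  ⟨1, le_rfl, h⟩

variable {V : Type u} (children : V → List V) (j : V → ℕ)

theorem reachesIn_count (x : V) (s : List (List V)) (ys : List V) : ∀ (k : ℕ) (other : List V),
    ReachesIn (step children j) ys.length (.count x k ys other s)
      (.count x (k + ys.countP (j · = j x)) []
        ((ys.filter (j · ≠ j x)).reverse ++ other) s) := by
  induction ys with
  | nil => exact fun k other => ⟨0, le_rfl, by simp⟩
  | cons y ys ih =>
    intro k other
    rw [List.length_cons, add_comm]
    by_cases h : j y = j x
    · refine (ReachesIn.single (b := .count x (k + 1) ys other s) (by simp [step, h])).trans ?_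
      convert ih (k + 1) other using 2
      · simp [h]; lia
      · simp [h]
    · refine (ReachesIn.single (b := .count x k ys (y :: other) s) (by simp [step, h])).trans ?_
      convert ih k (y :: other) using 2
      · simp [h]
      · simp [h]

open Classical in
-- Here `P` stands for niceness and `m` for subtree size. The induction is on a length bound because
-- the next list is a reversed filter, not a tail.
theorem reachesIn_loop (P : V → Prop) (m : V → ℕ) (n : ℕ) : ∀ (todo : List V), todo.length ≤ n →
    (∀ x ∈ todo, ∀ y ∈ todo, j x = j y → (P x ↔ P y)) →
    (∀ x ∈ todo, 1 ≤ m x) →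
    (∀ x ∈ todo, children x = [] → ¬ P x) →
    (∀ x ∈ todo, children x ≠ [] → ∀ s, ReachesIn (step children j) (2 * m x ^ 2)
      (.loop (children x) s) (.ret (P x) s)) →
    ∀ s, ReachesIn (step children j) (2 * (1 + (todo.map m).sum) ^ 2) (.loop todo s)
      (.ret (∀ x ∈ todo, Odd (todo.countP (j · = j x)) → P x : Prop) s) := by
  induction n with
  | zero =>
    intro todo hn _ _ _ _ s
    obtain rfl := List.eq_nil_of_length_eq_zero (Nat.le_zero.1 hn)
    exact (ReachesIn.single (by simp [step])).mono (by simp)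
  | succ n ih =>
    intro todo hn hP hm hleaf hrec s
    cases todo with
    | nil => exact (ReachesIn.single (by simp [step])).mono (by simp)
    | cons x xs =>
      set other := (xs.filter (j · ≠ j x)).reverse with hother
      have hmem : ∀ y, y ∈ other ↔ y ∈ xs ∧ j y ≠ j x := fun y => by simp [hother]
      have hsub : ∀ y ∈ other, y ∈ x :: xs := fun y hy => by simp [((hmem y).1 hy).1]
      have hcnt : ∀ y ∈ other, (x :: xs).countP (j · = j y) = other.countP (j · = j y) := by
        intro y hy
        have hxy : j y ≠ j x := ((hmem y).1 hy).2
        rw [hother, List.countP_reverse, List.countP_filter,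
          List.countP_cons_of_neg (by simpa using hxy.symm)]
        refine List.countP_congr fun z _ => ?_
        simp only [decide_eq_true_eq, Bool.and_eq_true]
        exact ⟨fun h => ⟨h, by rw [h]; exact hxy⟩, fun h => h.1⟩
      have hlen : other.length ≤ xs.length := by
        rw [hother, List.length_reverse]; exact List.length_filter_le _ _
      have hother_rec := ih other (by rw [List.length_cons] at hn; lia)
        (fun y hy z hz => hP y (hsub y hy) z (hsub z hz))
        (fun y hy => hm y (hsub y hy)) (fun y hy => hleaf y (hsub y hy))
        (fun y hy => hrec y (hsub y hy)) s
      have hlen_le : xs.length ≤ (xs.map m).sum := by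
        simpa using List.card_nsmul_le_sum (xs.map m) 1 (by
          simpa using fun y hy => hm y (List.mem_cons_of_mem x hy))
      have hsum_le : (other.map m).sum ≤ (xs.map m).sum := by
        rw [hother, List.map_reverse, List.sum_reverse]
        exact (List.filter_sublist.map m).sum_le_sum fun _ _ => Nat.zero_le _
      -- Filtering removes exactly the class of `x`, so the other classes keep their sizes.
      have hiff : (∀ y ∈ x :: xs, Odd ((x :: xs).countP (j · = j y)) → P y) ↔
          (Odd (1 + xs.countP (j · = j x)) → P x) ∧
            ∀ y ∈ other, Odd (other.countP (j · = j y)) → P y := by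
        have hx : (x :: xs).countP (j · = j x) = 1 + xs.countP (j · = j x) := by
          rw [List.countP_cons_of_pos (by simp), add_comm]
        refine ⟨fun h => ⟨fun ho => h x (by simp) (hx ▸ ho), fun y hy ho =>
          h y (hsub y hy) (by rwa [hcnt y hy])⟩, fun ⟨h1, h2⟩ y hy ho => ?_⟩
        by_cases hyx : j y = j x
        · rw [hyx, hx] at ho
          exact (hP y hy x (by simp) hyx).2 (h1 ho)
        · have hy' : y ∈ other :=
            (hmem y).2 ⟨(List.mem_cons.1 hy).resolve_left fun e => hyx (e ▸ rfl), hyx⟩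
          exact h2 y hy' (by rwa [← hcnt y hy'])
      have hstart := (ReachesIn.single (f := step children j) (a := .loop (x :: xs) s) rfl).trans
        (reachesIn_count children j x s xs 1 [])
      rw [List.append_nil, ← hother] at hstart
      have hmx := hm x (by simp)
      -- Start, scan, parity test, recursive call, return, remaining loop. As `m ≥ 1`, the scan
      -- costs at most the sum of `m` over `xs`.
      have hcost : 1 + xs.length + 1 + 2 * m x ^ 2 + 1 + 2 * (1 + (other.map m).sum) ^ 2 ≤
          2 * (1 + ((x :: xs).map m).sum) ^ 2 := by
        rw [List.map_cons, List.sum_cons]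
        obtain ⟨c, hc⟩ := Nat.exists_eq_add_of_le hsum_le
        rw [hc] at hlen_le ⊢
        generalize (other.map m).sum = a at *
        generalize m x = b at *
        obtain ⟨d, rfl⟩ := Nat.exists_eq_add_of_le hmx
        nlinarith [Nat.zero_le (a * d), Nat.zero_le (a * c), Nat.zero_le (d * c)]
      refine ReachesIn.mono ?_ hcost
      simp only [hiff]
      by_cases hodd : Odd (1 + xs.countP (j · = j x))
      · have hmod := Nat.odd_iff.1 hodd
        simp only [hodd, forall_const]
        cases hc : children x with
        | nil =>
          have hx := hleaf x (by simp) hc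
          refine (hstart.trans (.single ?_)).mono (by lia)
          simp [step, hmod, hc, hx]
        | cons c cs =>
          have hcall := (hstart.trans (.single (b := .loop (children x) (other :: s))
            (by simp [step, hmod, hc]))).trans (hrec x (by simp) (by simp [hc]) (other :: s))
          by_cases hx : P x
          · simp only [hx, true_and] at hcall ⊢
            exact (hcall.trans (.single (by simp [step]))).trans hother_rec
          · simp only [hx, false_and] at hcall ⊢
            exact (hcall.trans (.single (by simp [step]))).mono (by lia)
      · have hmod : ¬ (1 + xs.countP (j · = j x)) % 2 = 1 := fun h => hodd (Nat.odd_iff.2 h)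
        simp only [hodd, false_imp_iff, true_and]
        exact ((hstart.trans (.single (b := .loop other s)
          (by simp only [step, if_neg hmod]))).trans hother_rec).mono (by lia)

/-- Halted states are fixed points of `step`, so "within `n` steps" becomes "at time `n`". -/
theorem ReachesIn.run_eq {r : V} {n : ℕ} {b : Bool}
    (h : ReachesIn (step children j) n (.loop (children r) []) (.ret b [])) :
    ReturnsWithin children j r b n := by
  obtain ⟨t, ht, h⟩ := h
  rw [ReturnsWithin, run, ← Nat.sub_add_cancel ht, Function.iterate_add_apply, h]
  exact Function.iterate_fixed (by cases b <;> rfl) _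

theorem ReturnsWithin.mono {r : V} {m n : ℕ} {b : Bool} (h : ReturnsWithin children j r b m)
    (hmn : m ≤ n) : ReturnsWithin children j r b n :=
  ReachesIn.run_eq children j ⟨m, hmn, h⟩

theorem ReturnsWithin.unique {r : V} {m n : ℕ} {b c : Bool} (hb : ReturnsWithin children j r b m)
    (hc : ReturnsWithin children j r c n) : b = c := by
  have h1 := hb.mono children j (le_max_left m n)
  have h2 := hc.mono children j (le_max_right m n)
  rw [ReturnsWithin] at h1 h2
  rw [h1] at h2
  simpa using h2

end Machine

/-! ### Correctness and running time -/

section Main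

variable {T : RootedTree.{u}} {L : Type v} {label : T → L} {j : T → ℕ} {children : T → List T}

theorem IsChildLists.eq_nil_iff [Finite T] (hc : IsChildLists children) (x : T) :
    children x = [] ↔ IsLeaf x := by
  rw [List.eq_nil_iff_forall_not_mem]
  simp only [(hc x).2]
  refine ⟨fun h => ?_, fun h y hy => hy.1.not_ge (h hy.1.le)⟩
  by_contra hx
  obtain ⟨y, hy⟩ := not_isMax_iff.1 hx
  obtain ⟨z, hz, -⟩ := exists_covBy_le_of_lt hy
  exact h z hz

open Classical in
theorem reachesIn_niceAt [Finite T] (hj : IsJNumbering label j) (hc : IsChildLists children)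
    (v : T) (hv : ¬ IsLeaf v) (s : List (List T)) :
    ReachesIn (step children j) (2 * (Set.Ici v).ncard ^ 2) (.loop (children v) s)
      (.ret (NiceAt label v) s) := by
  induction v using (wellFounded_gt (α := T)).induction generalizing s with
  | _ v ih =>
    have hcov : ∀ y ∈ children v, v ⋖ y := fun y => ((hc v).2 y).1
    have hcard : ∀ x, #{y ∈ (children v).toFinset | j y = j x} =
        (children v).countP (j · = j x) := fun x => by
      rw [List.countP_eq_length_filter, ← List.toFinset_card_of_nodup ((hc v).1.filter _),
        List.toFinset_filter]
      simp
    have hnice := hj.niceAt_iff_forall hv (s := (children v).toFinset) (by simp [(hc v).2])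
    simp only [hcard, List.mem_toFinset] at hnice
    have hloop := reachesIn_loop children j (NiceAt label) (fun x => (Set.Ici x).ncard) _
      (children v) le_rfl (fun x hx y hy => hj.niceAt_iff (hcov x hx) (hcov y hy))
      (fun x _ => (Set.ncard_pos (Set.toFinite _)).2 ⟨x, le_rfl⟩)
      (fun x _ hx => ((hc.eq_nil_iff x).1 hx).not_niceAt)
      (fun x hx hne => ih x (hcov x hx).1 fun h => hne ((hc.eq_nil_iff x).2 h)) s
    simp only [← hnice] at hloop
    refine hloop.mono (Nat.mul_le_mul_left 2 (Nat.pow_le_pow_left ?_ 2))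
    rw [← List.sum_toFinset _ (hc v).1]
    exact one_add_sum_ncard_Ici_le (by simpa using hcov)

end Main

end TreeInvolution

/-- The constant `C` of the time bound is absolute: it depends neither on the tree, nor on its
labels, its `j`-numbering or the order in which the children are stored. -/
theorem lemma5p8 :
    ∃ C : ℕ, ∀ (T : RootedTree.{u}) [Finite T] [Nontrivial T] (L : Type v) (label : T → L)
      (j : T → ℕ) (children : T → List T),
      TreeInvolution.IsJNumbering label j → TreeInvolution.IsChildLists children →
        (TreeInvolution.Returns children j ⊥ true ↔
          ∃ σ : TreeInvolution.LabeledAut label, σ.IsFixedPointFreeInvolutionOnLeaves) ∧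
        ∃ b : Bool, TreeInvolution.ReturnsWithin children j ⊥ b (C * Nat.card T ^ 2) := by
  classical
  refine ⟨2, fun T _ _ L label j children hj hc => ?_⟩
  have hbot : ¬ TreeInvolution.IsLeaf (⊥ : T) := not_isMax_bot
  have h := TreeInvolution.ReachesIn.run_eq children j
    (TreeInvolution.reachesIn_niceAt hj hc ⊥ hbot [])
  rw [Set.Ici_bot, Set.ncard_univ] at h
  refine ⟨?_, _, h⟩
  rw [← TreeInvolution.niceAt_bot]
  refine ⟨fun ⟨t, ht⟩ => ?_, fun hn => ⟨_, by simpa [hn] using h⟩⟩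
  simpa using TreeInvolution.ReturnsWithin.unique children j h ht
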